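/- All graphs are finite, edge-weighted directed graphs $G=(V,E,c)$ with $E\subseteq V\times V$ (so no parallel edges), without self-loops, and with $c:E\to\mathbb{R}$. A walk from $u$ to $v$ is a sequence of nodes $(u=i_0,i_1,\dots,i_m=v)$, $m\ge 0$, with $(i_{l},i_{l+1})\in E$ for all $0\le l<m$; its weight is the sum of the weights of its edges, counted with multiplicity. It is closed if $u=v$, and it is a path if its nodes are distinct. A set $R\subseteq E$ is a redundant edge set of $G$ if for every $(u,v)\in R$ there is a path from $u$ to $v$ in $(V,E\setminus R,c)$ of weight at most $c_{uv}$; a maximum redundant edge set is a redundant edge set of maximum cardinality. Let $G=(V,E,c)$ have no closed walk of negative weight, and let $d_{ij}$ be the minimum weight of a walk from $i$ to $j$ in $G$ (when there is one). Write $i\sim j$ if $i=j$ or some closed walk of weight zero traverses both $i$ and $j$. Let $K$ be the number of classes of the equivalence relation $\sim$ on $V$, and choose one arbitrary representing node from each class, $v_1,\dots,v_K$; $[v_k]$ is the class of $v_k$. Put $$E_k^r=\{(i,j)\in E: i,j\in[v_k],\ c_{ij}>d_{ij}\},\qquad E_k^c=\{(i,j)\in E: i,j\in[v_k],\ c_{ij}=d_{ij}\},$$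 and, for $i\ne j$, $$E_{ij}=\{(s,t)\in E: s\in[v_i],\ t\in[v_j]\},\qquad E_{ij}^c=\operatorname*{argmin}_{(s,t)\in E_{ij}}\bigl(d_{v_is}+c_{st}+d_{tv_j}\bigr).$$ The condensation $\tilde G$ of $G$ is the graph with node set $\{v_1,\dots,v_K\}$, with an edge $(v_i,v_j)$ ($i\neq j$) if and only if $E_{ij}\ne\emptyset$, and with weights $\tilde c_{v_iv_j}=\min_{(s,t)\in E_{ij}}\bigl(d_{v_is}+c_{st}+d_{tv_j}\bigr)$. Then $\tilde G$ has exactly one maximum redundant edge set $\tilde R_0^\star$, and the maximum redundant edge sets of $G$ are exactly the sets of the form $$\Bigl(\bigcup_{1\le i\neq j\le K}R_{ij}^\star\Bigr)\cup\bigcup_{k=1}^K\bigl(E_k^r\cup R_k^\star\bigr),$$ where, for each $k$, $R_k^\star$ is a maximum redundant edge set of the graph $([v_k],E_k^c,c)$, and, for each $i\ne j$, $R_{ij}^\star=E_{ij}$ if $(v_i,v_j)\in\tilde R_0^\star$; $R_{ij}^\star=E_{ij}\setminus\{(g,h)\}$ for some $(g,h)\in E_{ij}^c$ if $E_{ij}\neq\emptyset$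 and $(v_i,v_j)\notin\tilde R_0^\star$; and $R_{ij}^\star=\emptyset$ if $E_{ij}=\emptyset$. -/

import Mathlib

/-- A finite edge-weighted directed graph whose nodes lie in an ambient type, without parallel
edges and without self-loops. Only the values of `weight` on `edges` are used. -/
structure WDigraph (α : Type*) where
  nodes : Finset α
  edges : Finset (α × α)
  weight : α × α → ℝ
  edge_nodes : ∀ e ∈ edges, e.1 ∈ nodes ∧ e.2 ∈ nodes
  edge_ne : ∀ e ∈ edges, e.1 ≠ e.2

namespace WDigraph

/-- `G.IsWalk u v p`: the node sequence `p` is a walk from `u` to `v` in `G`. The degenerate walk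
`[u]` at a node `u` is allowed. -/
inductive IsWalk {α : Type*} (G : WDigraph α) : α → α → List α → Prop
  | nil {u : α} (hu : u ∈ G.nodes) : IsWalk G u u [u]
  | cons {u v w : α} {p : List α} (h : (u, v) ∈ G.edges) (hp : IsWalk G v w p) :
      IsWalk G u w (u :: p)

/-- The sum of the weights of the edges traversed by a node sequence, with multiplicity. -/
def walkWeight {α : Type*} (G : WDigraph α) : List α → ℝ
  | [] => 0
  | [_] => 0
  | u :: v :: p => G.weight (u, v) + G.walkWeight (v :: p)

/-- A path is a walk whose traversed nodes are distinct. -/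
def IsPath {α : Type*} (G : WDigraph α) (u v : α) (p : List α) : Prop :=
  G.IsWalk u v p ∧ p.Nodup

/-- No closed walk has negative weight. -/
def NoNegClosedWalk {α : Type*} (G : WDigraph α) : Prop :=
  ∀ (u : α) (p : List α), G.IsWalk u u p → 0 ≤ G.walkWeight p

/-- The graph `(V, E \ R, c(E \ R))`. -/
def deleteEdges {α : Type*} [DecidableEq α] (G : WDigraph α) (R : Finset (α × α)) :
    WDigraph α where
  nodes := G.nodes
  edges := G.edges \ R
  weight := G.weight
  edge_nodes e he := G.edge_nodes e (Finset.mem_sdiff.mp he).1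
  edge_ne e he := G.edge_ne e (Finset.mem_sdiff.mp he).1

/-- `R` is a redundant edge set: each of its edges is replaced by a path, of no greater weight,
that avoids all of `R`. -/
def IsRedundant {α : Type*} [DecidableEq α] (G : WDigraph α) (R : Finset (α × α)) : Prop :=
  R ⊆ G.edges ∧ ∀ e ∈ R, ∃ p : List α,
    (G.deleteEdges R).IsPath e.1 e.2 p ∧ (G.deleteEdges R).walkWeight p ≤ G.weight e

/-- A redundant edge set of maximum cardinality. -/
def IsMaxRedundant {α : Type*} [DecidableEq α] (G : WDigraph α) (R : Finset (α × α)) : Prop :=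
  G.IsRedundant R ∧ ∀ R' : Finset (α × α), G.IsRedundant R' → R'.card ≤ R.card

/-- The relation `i ∼ j`: equal, or both traversed by one closed walk of weight zero. -/
def ZeroEquiv {α : Type*} (G : WDigraph α) (i j : α) : Prop :=
  i = j ∨ ∃ (u : α) (p : List α), G.IsWalk u u p ∧ G.walkWeight p = 0 ∧ i ∈ p ∧ j ∈ p

/-- The minimum weight `d i j` of a walk from `i` to `j`. If no closed walk is negative and there
is some walk from `i` to `j`, this infimum is attained; the value is used only for such pairs. -/
noncomputable def minWeight {α : Type*} (G : WDigraph α) (i j : α) : ℝ :=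
  sInf {r : ℝ | ∃ p : List α, G.IsWalk i j p ∧ G.walkWeight p = r}

/-- `v 0, …, v (K - 1)` are representing nodes, exactly one for each class of `∼`
(so `K` is the number of classes). -/
def IsClassReps {α : Type*} (G : WDigraph α) {K : ℕ} (v : Fin K → α) : Prop :=
  (∀ k, v k ∈ G.nodes) ∧ ∀ i ∈ G.nodes, ∃! k, G.ZeroEquiv i (v k)

open Classical in
/-- The class `[x]` of a node `x`. -/
noncomputable def zeroClass {α : Type*} (G : WDigraph α) (x : α) : Finset α :=
  G.nodes.filter fun i => G.ZeroEquiv i x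

open Classical in
/-- The edges from the class `[x]` to the class `[y]`: this is `E_ij` for `x = v i`, `y = v j`,
and `E_k` for `x = y = v k`. -/
noncomputable def edgesBetween {α : Type*} (G : WDigraph α) (x y : α) : Finset (α × α) :=
  G.edges.filter fun e => e.1 ∈ G.zeroClass x ∧ e.2 ∈ G.zeroClass y

open Classical in
/-- The set `E_k^r` for `x = v k`: edges inside `[x]` with weight above the minimum walk weight. -/
noncomputable def intraSlack {α : Type*} (G : WDigraph α) (x : α) : Finset (α × α) :=
  (G.edgesBetween x x).filter fun e => G.minWeight e.1 e.2 < G.weight e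

open Classical in
/-- The set `E_k^c` for `x = v k`: edges inside `[x]` with weight equal to the minimum walk
weight. -/
noncomputable def intraTight {α : Type*} (G : WDigraph α) (x : α) : Finset (α × α) :=
  (G.edgesBetween x x).filter fun e => G.weight e = G.minWeight e.1 e.2

open Classical in
/-- The graph `([v_k], E_k^c, c(E_k^c))` for `x = v k`. -/
noncomputable def tightSubgraph {α : Type*} (G : WDigraph α) (x : α) : WDigraph α where
  nodes := G.zeroClass x
  edges := G.intraTight x
  weight := G.weight
  edge_nodes _ he :=
    (Finset.mem_filter.mp (Finset.mem_filter.mp he).1).2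
  edge_ne e he :=
    G.edge_ne e (Finset.mem_filter.mp (Finset.mem_filter.mp he).1).1

/-- For an edge `e = (s, t)`, the quantity `d x s + c s t + d t y`. -/
noncomputable def viaWeight {α : Type*} (G : WDigraph α) (x y : α) (e : α × α) : ℝ :=
  G.minWeight x e.1 + G.weight e + G.minWeight e.2 y

open Classical in
/-- The set `E_ij^c` for `x = v i`, `y = v j`: the edges of `E_ij` minimizing
`d x s + c s t + d t y`. -/
noncomputable def interTight {α : Type*} (G : WDigraph α) (x y : α) : Finset (α × α) :=
  (G.edgesBetween x y).filter fun e =>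
    ∀ f ∈ G.edgesBetween x y, G.viaWeight x y e ≤ G.viaWeight x y f

open Classical in
/-- The condensation of `G` with representing nodes `v`: its nodes are the representing nodes,
there is an edge between two distinct ones if and only if `G` has an edge between their classes,
and its weight is the minimum of `d x s + c s t + d t y` over these edges `(s, t)` of `G`. -/
noncomputable def condensation {α : Type*} (G : WDigraph α) {K : ℕ} (v : Fin K → α) :
    WDigraph α where
  nodes := Finset.univ.image v
  edges := ((Finset.univ.image v) ×ˢ (Finset.univ.image v)).filter fun e =>
    e.1 ≠ e.2 ∧ (G.edgesBetween e.1 e.2).Nonempty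
  weight e :=
    if h : (G.edgesBetween e.1 e.2).Nonempty then
      (G.edgesBetween e.1 e.2).inf' h (G.viaWeight e.1 e.2)
    else 0
  edge_nodes _ he := Finset.mem_product.mp (Finset.mem_filter.mp he).1
  edge_ne _ he := (Finset.mem_filter.mp he).2.1

end WDigraph

namespace WDigraph

/-! Without negative closed walks, paths may be traded for walks, so R is redundant iff E \ R
contains, for every edge of E, a walk of no greater weight (`isRedundant_iff`). Everything rests on
deciding this condition separately on each set of edges from one class to another.

Within a class, d(i,j) + d(j,i) = 0. A shortest walk between equivalent nodes therefore never leaves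
the class and uses only tight edges (`HasWalk.inter_intraTight`): slack edges may be deleted freely,
and the tight ones form an independent problem. Between classes, rerouting through representatives
costs nothing, so walks of G project to the condensation (`HasWalk.project`) and its walks lift
back. Every nontrivial closed walk of the condensation is positive, so its edges replaceable by
walks with at least two edges can all be deleted at once; they form the greatest redundant set,
hence the only maximum one (`isMaxRedundant_iff_eq_replaceable`).

Together (`preserves_iff`): R is redundant iff its tight part in each class is redundant there and,
for each irreplaceable condensation edge, R misses some minimizing edge. Such constraints on
disjoint blocks are maximized block by block (`isMax_iff_forall_block`), which yields the stated
form. -/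

/-- `HasWalk c H u v n r`: some walk from `u` to `v` with edges in `H` has `n` edges and weight
`r` with respect to `c`. -/
inductive HasWalk {α : Type*} (c : α × α → ℝ) (H : Set (α × α)) : α → α → ℕ → ℝ → Prop
  | nil (u : α) : HasWalk c H u u 0 0
  | cons {u v w : α} {n : ℕ} {r : ℝ} (h : (u, v) ∈ H) (hp : HasWalk c H v w n r) :
      HasWalk c H u w (n + 1) (c (u, v) + r)

/-- Some walk from `u` to `v` with edges in `H` has weight `r`. -/
def Reach {α : Type*} (c : α × α → ℝ) (H : Set (α × α)) (u v : α) (r : ℝ) : Prop :=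
  ∃ n, HasWalk c H u v n r

/-- Every edge of `E` is replaced by a walk in `H` of no greater weight. -/
def Preserves {α : Type*} (c : α × α → ℝ) (H E : Set (α × α)) : Prop :=
  ∀ e ∈ E, ∃ r ≤ c e, Reach c H e.1 e.2 r

/-- All closed walks with edges in `E` have nonnegative weight. -/
def NoNeg {α : Type*} (c : α × α → ℝ) (E : Set (α × α)) : Prop :=
  ∀ u r, Reach c E u u r → 0 ≤ r

/-- There are walks from `i` to `j` and back whose weights add up to zero. -/
def ZeroRel {α : Type*} (c : α × α → ℝ) (E : Set (α × α)) (i j : α) : Prop :=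
  ∃ r, Reach c E i j r ∧ Reach c E j i (-r)

/-! ### Weighted walks in an edge set, and replacement of edges by walks. -/

section Walks

variable {α : Type*} {c : α × α → ℝ} {H E : Set (α × α)} {u v w : α} {n m : ℕ} {r s : ℝ}

theorem HasWalk.trans (h₁ : HasWalk c H u v n r) (h₂ : HasWalk c H v w m s) :
    HasWalk c H u w (n + m) (r + s) := by
  induction h₁ with
  | nil u => simpa using h₂
  | cons h _ ih =>
    have := HasWalk.cons h (ih h₂)
    rw [← add_assoc] at this
    convert this using 1
    omega

theorem HasWalk.mono (hHE : H ⊆ E) (h : HasWalk c H u v n r) : HasWalk c E u v n r := by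
  induction h with
  | nil u => exact .nil u
  | cons h _ ih => exact .cons (hHE h) ih

theorem Reach.refl (u : α) : Reach c H u u 0 := ⟨0, .nil u⟩

theorem Reach.trans (h₁ : Reach c H u v r) (h₂ : Reach c H v w s) :
    Reach c H u w (r + s) :=
  ⟨_, h₁.choose_spec.trans h₂.choose_spec⟩

theorem Reach.mono (hHE : H ⊆ E) (h : Reach c H u v r) : Reach c E u v r :=
  ⟨_, h.choose_spec.mono hHE⟩

theorem Reach.edge (h : (u, v) ∈ H) : Reach c H u v (c (u, v)) :=
  ⟨1, by simpa using HasWalk.cons h (.nil v)⟩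

theorem NoNeg.mono (hHE : H ⊆ E) (h : NoNeg c E) : NoNeg c H :=
  fun u r hr => h u r (hr.mono hHE)

/-- An edge has distinct ends, so whatever replaces it has at least one edge. Hence the number of
edges never drops, and a replacement with at least two edges remains one after further deletions. -/
theorem Preserves.hasWalk (hne : ∀ e ∈ E, e.1 ≠ e.2) (hP : Preserves c H E)
    (h : HasWalk c E u v n r) : ∃ m ≥ n, ∃ s ≤ r, HasWalk c H u v m s := by
  induction h with
  | nil u => exact ⟨0, le_rfl, 0, le_rfl, .nil u⟩
  | cons h _ ih =>
    obtain ⟨m, hm, s, hs, hw⟩ := ih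
    obtain ⟨t, ht, k, hk⟩ := hP _ h
    have hk0 : 1 ≤ k := by
      rcases k with _ | k
      · exfalso
        cases hk
        exact hne _ h rfl
      · omega
    exact ⟨k + m, by omega, t + s, by linarith, hk.trans hw⟩

theorem Preserves.reach (hP : Preserves c H E) (h : Reach c E u v r) :
    ∃ s ≤ r, Reach c H u v s := by
  obtain ⟨n, h⟩ := h
  induction h with
  | nil u => exact ⟨0, le_rfl, .refl u⟩
  | cons h _ ih =>
    obtain ⟨s, hs, hw⟩ := ih
    obtain ⟨t, ht, hk⟩ := hP _ h
    exact ⟨t + s, by linarith, hk.trans hw⟩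

theorem HasWalk.avoids_or_traverses (e : α × α) (h : HasWalk c H u v n r) :
    HasWalk c (H \ {e}) u v n r ∨ ∃ n₁ r₁ n₂ r₂, HasWalk c H u e.1 n₁ r₁ ∧
      HasWalk c H e.2 v n₂ r₂ ∧ n = n₁ + n₂ + 1 ∧ r = r₁ + c e + r₂ := by
  induction h with
  | nil u => exact .inl (.nil u)
  | @cons u v w n r h hp ih =>
    by_cases he : (u, v) = e
    · subst he
      exact .inr ⟨0, 0, n, r, .nil u, hp, by omega, by ring⟩
    · rcases ih with ih | ⟨n₁, r₁, n₂, r₂, h₁, h₂, rfl, rfl⟩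
      · exact .inl (.cons ⟨h, he⟩ ih)
      · exact .inr ⟨n₁ + 1, _, n₂, r₂, .cons h h₁, h₂, by omega, by ring⟩

theorem finite_hasWalk_weights (hH : H.Finite) (n : ℕ) :
    ∀ u v : α, {r | HasWalk c H u v n r}.Finite := by
  induction n with
  | zero =>
    intro u v
    refine (Set.finite_singleton (0 : ℝ)).subset ?_
    intro r hr
    cases hr
    rfl
  | succ n ih =>
    intro u v
    refine (hH.biUnion (t := fun e => (fun r => c e + r) '' {r | HasWalk c H e.2 v n r})
      fun e _ => (ih e.2 v).image _).subset ?_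
    intro r hr
    cases hr with
    | cons h hp => exact Set.mem_biUnion h ⟨_, hp, rfl⟩

/-- A graph all of whose nontrivial closed walks are positive keeps its distances when all the
edges replaceable by walks of at least two edges are deleted. -/
theorem preserves_sdiff_of_pos [DecidableEq α] (hne : ∀ e ∈ E, e.1 ≠ e.2)
    (hpos : ∀ u n r, HasWalk c E u u (n + 1) r → 0 < r) (S : Finset (α × α))
    (hS : ∀ e ∈ S, ∃ n ≥ 2, ∃ r ≤ c e, HasWalk c E e.1 e.2 n r) :
    Preserves c (E \ S) E := by
  induction S using Finset.induction_on with
  | empty => exact fun e he => ⟨c e, le_rfl, .edge (by simpa using he)⟩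
  | insert e S _ ih =>
    have ih := ih fun e he => hS e (Finset.mem_insert_of_mem he)
    obtain ⟨n, hn, r, hr, hw⟩ := hS e (Finset.mem_insert_self e S)
    obtain ⟨m, hm, s, hs, hw⟩ := ih.hasWalk hne hw
    -- If the replacement of `e` traversed `e`, the pieces before and after would be closed walks of
    -- total weight at most 0. Positivity makes both trivial, leaving a single edge where there are
    -- at least two.
    have key : HasWalk c ((E \ S) \ {e}) e.1 e.2 m s := by
      rcases hw.avoids_or_traverses e with h | ⟨n₁, r₁, n₂, r₂, h₁, h₂, rfl, rfl⟩
      · exact h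
      · exfalso
        replace h₁ := h₁.mono Set.sdiff_subset
        replace h₂ := h₂.mono Set.sdiff_subset
        have g₁ : 0 < r₁ ∨ n₁ = 0 ∧ r₁ = 0 := by
          cases n₁ with
          | zero => cases h₁; exact .inr ⟨rfl, rfl⟩
          | succ k => exact .inl (hpos _ _ _ h₁)
        have g₂ : 0 < r₂ ∨ n₂ = 0 ∧ r₂ = 0 := by
          cases n₂ with
          | zero => cases h₂; exact .inr ⟨rfl, rfl⟩
          | succ k => exact .inl (hpos _ _ _ h₂)
        rcases g₁ with g₁ | ⟨rfl, rfl⟩ <;> rcases g₂ with g₂ | ⟨rfl, rfl⟩ <;>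
          first | omega | linarith
    have hsub : (E \ S) \ {e} = E \ ((insert e S : Finset (α × α)) : Set (α × α)) := by
      ext x; simp; tauto
    rw [← hsub]
    intro f hf
    obtain ⟨t, ht, h⟩ := ih f hf
    have hP : Preserves c ((E \ S) \ {e}) (E \ S) := by
      intro g hg
      by_cases hge : g = e
      · subst hge
        exact ⟨s, hs.trans hr, m, key⟩
      · exact ⟨c g, le_rfl, .edge ⟨hg, hge⟩⟩
    obtain ⟨t', ht', h'⟩ := hP.reach h
    exact ⟨t', ht'.trans ht, h'⟩

end Walks

/-! ### Paths, minimum weights and redundancy in terms of walks. -/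

section Graph

variable {α : Type*} {G : WDigraph α} {u v w i j : α} {p : List α} {n : ℕ} {r : ℝ}

theorem IsWalk.cons_eq (h : G.IsWalk u v p) : ∃ q, p = u :: q := by
  cases h <;> exact ⟨_, rfl⟩

theorem IsWalk.mem_nodes (h : G.IsWalk u v p) : ∀ x ∈ p, x ∈ G.nodes := by
  induction h with
  | nil hu => simpa using hu
  | cons h _ ih =>
    intro x hx
    rcases List.mem_cons.mp hx with rfl | hx
    · exact (G.edge_nodes _ h).1
    · exact ih x hx

theorem walkWeight_cons (h : G.IsWalk v w p) :
    G.walkWeight (u :: p) = G.weight (u, v) + G.walkWeight p := by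
  obtain ⟨q, rfl⟩ := h.cons_eq
  rfl

theorem IsWalk.hasWalk (h : G.IsWalk u v p) :
    HasWalk G.weight G.edges u v (p.length - 1) (G.walkWeight p) := by
  induction h with
  | nil hu => exact .nil _
  | cons h hp ih =>
    rw [walkWeight_cons hp]
    have := HasWalk.cons (Finset.mem_coe.mpr h) ih
    obtain ⟨q, rfl⟩ := hp.cons_eq
    simpa using this

theorem IsWalk.reach (h : G.IsWalk u v p) : Reach G.weight G.edges u v (G.walkWeight p) :=
  ⟨_, h.hasWalk⟩

theorem Reach.exists_isWalk (hu : u ∈ G.nodes) (h : Reach G.weight G.edges u v r) :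
    ∃ p, G.IsWalk u v p ∧ G.walkWeight p = r := by
  obtain ⟨n, h⟩ := h
  induction h with
  | nil u => exact ⟨[u], .nil hu, rfl⟩
  | cons h _ ih =>
    obtain ⟨p, hp, rfl⟩ := ih (G.edge_nodes _ h).2
    exact ⟨_, .cons h hp, walkWeight_cons hp⟩

theorem Reach.mem_nodes (hu : u ∈ G.nodes) (h : Reach G.weight G.edges u v r) :
    v ∈ G.nodes := by
  obtain ⟨n, h⟩ := h
  induction h with
  | nil u => exact hu
  | cons h _ ih => exact ih (G.edge_nodes _ h).2

theorem IsWalk.split (h : G.IsWalk u v p) (hw : w ∈ p) :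
    ∃ s q, Reach G.weight G.edges u w s ∧ G.IsWalk w v q ∧ q <:+ p ∧
      G.walkWeight p = s + G.walkWeight q := by
  induction h with
  | nil hu =>
    obtain rfl := List.mem_singleton.mp hw
    exact ⟨0, _, .refl _, .nil hu, List.suffix_rfl, by simp⟩
  | @cons u v x p h hp ih =>
    rcases List.mem_cons.mp hw with rfl | hw
    · exact ⟨0, _, .refl _, .cons h hp, List.suffix_rfl, by simp⟩
    · obtain ⟨s, q, h₁, h₂, h₃, h₄⟩ := ih hw
      exact ⟨_, q, (Reach.edge (Finset.mem_coe.mpr h)).trans h₁, h₂,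
        h₃.trans (List.suffix_cons _ _), by rw [walkWeight_cons hp, h₄, add_assoc]⟩

theorem noNegClosedWalk_iff_noNeg : G.NoNegClosedWalk ↔ NoNeg G.weight G.edges := by
  refine ⟨fun h u r hr => ?_, fun h u p hp => h u _ hp.reach⟩
  by_cases hu : u ∈ G.nodes
  · obtain ⟨p, hp, rfl⟩ := hr.exists_isWalk hu
    exact h u p hp
  -- `HasWalk` allows the trivial walk at points outside the graph, and no other walk starts there.
  · obtain ⟨n, hr⟩ := hr
    cases hr with
    | nil => exact le_rfl
    | cons h _ => exact absurd (G.edge_nodes _ h).1 hu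

theorem IsWalk.exists_isPath (hG : NoNeg G.weight G.edges) (h : G.IsWalk u v p) :
    ∃ q, G.IsPath u v q ∧ G.walkWeight q ≤ G.walkWeight p := by
  induction h with
  | nil hu => exact ⟨_, ⟨.nil hu, by simp⟩, le_rfl⟩
  | @cons u v x p h hp ih =>
    obtain ⟨q, ⟨hq, hnd⟩, hle⟩ := ih
    rw [walkWeight_cons hp]
    by_cases hu : u ∈ q
    · obtain ⟨s, q', h₁, h₂, h₃, h₄⟩ := hq.split hu
      refine ⟨q', ⟨h₂, hnd.sublist h₃.sublist⟩, ?_⟩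
      have := hG u _ ((Reach.edge (Finset.mem_coe.mpr h)).trans h₁)
      linarith
    · exact ⟨u :: q, ⟨.cons h hq, List.nodup_cons.mpr ⟨hu, hnd⟩⟩, by
        rw [walkWeight_cons hq]; linarith⟩

theorem IsPath.length_le (h : G.IsPath u v p) : p.length ≤ G.nodes.card := by
  classical
  rw [← List.toFinset_card_of_nodup h.2]
  exact Finset.card_le_card fun x hx => h.1.mem_nodes x (List.mem_toFinset.mp hx)

/-- Every walk is dominated by a path, whose length is bounded by the number of nodes, and walks of
bounded length have finitely many weights. -/
theorem exists_min_reach (hG : NoNeg G.weight G.edges) (hu : u ∈ G.nodes)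
    (h : Reach G.weight G.edges u v r) :
    ∃ s, Reach G.weight G.edges u v s ∧ ∀ t, Reach G.weight G.edges u v t → s ≤ t := by
  set A : Set ℝ := ⋃ n ∈ Set.Iic G.nodes.card, {r | HasWalk G.weight G.edges u v n r} with hA
  have hfin : A.Finite := (Set.finite_Iic _).biUnion fun n _ =>
    finite_hasWalk_weights G.edges.finite_toSet n u v
  have hle : ∀ t, Reach G.weight G.edges u v t → ∃ s ∈ A, s ≤ t := by
    intro t ht
    obtain ⟨p, hp, rfl⟩ := ht.exists_isWalk hu
    obtain ⟨q, hq, hqp⟩ := hp.exists_isPath hG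
    exact ⟨_, Set.mem_biUnion (Set.mem_Iic.mpr ((Nat.sub_le _ 1).trans hq.length_le))
      hq.1.hasWalk, hqp⟩
  obtain ⟨a, ha, -⟩ := hle r h
  obtain ⟨s, hs, hmin⟩ := Set.exists_min_image A id hfin ⟨a, ha⟩
  obtain ⟨n, -, hn⟩ := Set.mem_iUnion₂.mp hs
  refine ⟨s, ⟨n, hn⟩, fun t ht => ?_⟩
  obtain ⟨b, hb, hbt⟩ := hle t ht
  exact (hmin b hb).trans hbt

theorem minWeight_isLeast (hG : NoNeg G.weight G.edges) (hu : u ∈ G.nodes)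
    (h : Reach G.weight G.edges u v r) :
    Reach G.weight G.edges u v (G.minWeight u v) ∧ G.minWeight u v ≤ r := by
  obtain ⟨s, hs, hmin⟩ := exists_min_reach hG hu h
  have : IsLeast {r : ℝ | ∃ p : List α, G.IsWalk u v p ∧ G.walkWeight p = r} s :=
    ⟨hs.exists_isWalk hu, by rintro t ⟨p, hp, rfl⟩; exact hmin _ hp.reach⟩
  rw [minWeight, this.csInf_eq]
  exact ⟨hs, hmin r h⟩

theorem zeroEquiv_iff (hi : i ∈ G.nodes) :
    G.ZeroEquiv i j ↔ ZeroRel G.weight G.edges i j := by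
  constructor
  · rintro (rfl | ⟨u, p, hp, h0, hi, hj⟩)
    · exact ⟨0, .refl i, by simpa using Reach.refl i⟩
    · obtain ⟨a, q, h₁, h₂, -, h₃⟩ := hp.split hi
      obtain ⟨b, q', h₄, h₅, -, h₆⟩ := hp.split hj
      -- Both connections go through the base point `u`: i → u → j and j → u → i. Together they run
      -- through the closed walk twice, so the order of `i` and `j` on it is irrelevant.
      refine ⟨G.walkWeight q + b, h₂.reach.trans h₄, ?_⟩
      convert h₅.reach.trans h₁ using 1
      linarith
  · rintro ⟨r, h₁, h₂⟩
    have hj := h₁.mem_nodes hi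
    obtain ⟨n, h₁⟩ := h₁
    have key : ∀ {u v w n r s}, HasWalk G.weight G.edges u v n r → u ∈ G.nodes →
        Reach G.weight G.edges v w s →
        ∃ p, G.IsWalk u w p ∧ G.walkWeight p = r + s ∧ u ∈ p ∧ v ∈ p := by
      intro u v w n r s h hu hs
      induction h with
      | nil u =>
        obtain ⟨p, hp, rfl⟩ := hs.exists_isWalk hu
        obtain ⟨q, rfl⟩ := hp.cons_eq
        exact ⟨_, hp, by simp⟩
      | cons h _ ih =>
        obtain ⟨p, hp, h₁, h₂, h₃⟩ := ih (G.edge_nodes _ h).2 hs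
        exact ⟨_, .cons h hp, by rw [walkWeight_cons hp, h₁, add_assoc], by simp, by simp [h₃]⟩
    obtain ⟨p, hp, h0, hi, hj⟩ := key h₁ hi h₂
    exact .inr ⟨i, p, hp, by rw [h0]; ring, hi, hj⟩

/-- Edges outside `R` replace themselves, and a replacing walk shortens to a path because cutting
out closed walks does not increase the weight. -/
theorem isRedundant_iff [DecidableEq α] (hG : NoNeg G.weight G.edges) {R : Finset (α × α)} :
    G.IsRedundant R ↔
      R ⊆ G.edges ∧ Preserves G.weight ((G.edges : Set (α × α)) \ R) G.edges := by
  have hE : ((G.deleteEdges R).edges : Set (α × α)) = (G.edges : Set (α × α)) \ R := by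
    simp [deleteEdges]
  refine and_congr_right fun hR => ⟨fun h e he => ?_, fun h e he => ?_⟩
  · by_cases heR : e ∈ R
    · obtain ⟨p, hp, hle⟩ := h e heR
      exact ⟨_, hle, hE ▸ hp.1.reach⟩
    · exact ⟨_, le_rfl, .edge ⟨he, heR⟩⟩
  · obtain ⟨r, hr, hw⟩ := h e (hR he)
    rw [← hE] at hw
    obtain ⟨p, hp, rfl⟩ := Reach.exists_isWalk (G := G.deleteEdges R)
      (G.edge_nodes e (hR he)).1 hw
    have hG' : NoNeg (G.deleteEdges R).weight (G.deleteEdges R).edges := by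
      rw [hE]
      exact hG.mono Set.sdiff_subset
    obtain ⟨q, hq, hle⟩ := hp.exists_isPath hG'
    exact ⟨q, hq, hle.trans hr⟩

end Graph

/-! ### Maximum cardinality under constraints on disjoint blocks. -/

section Blocks

variable {ι β : Type*} [DecidableEq β]

theorem card_eq_sum_card_inter [Fintype ι] {E : Finset β} {B : ι → Finset β}
    (hE : ∀ e, e ∈ E ↔ ∃ i, e ∈ B i) (hd : Pairwise fun i j => Disjoint (B i) (B j))
    {R : Finset β} (hR : R ⊆ E) : R.card = ∑ i, (R ∩ B i).card := by
  rw [← Finset.card_biUnion]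
  · congr 1
    ext e
    simp only [Finset.mem_biUnion, Finset.mem_univ, Finset.mem_inter, true_and]
    exact ⟨fun h => ((hE e).mp (hR h)).imp fun i hi => ⟨h, hi⟩, fun ⟨_, h, _⟩ => h⟩
  · exact fun i _ j _ hij =>
      (hd hij).mono Finset.inter_subset_right Finset.inter_subset_right

/-- If membership in a family of sets is decided block by block, then so is maximality. -/
theorem isMax_iff_forall_block [Fintype ι] {E : Finset β} {B : ι → Finset β}
    (hE : ∀ e, e ∈ E ↔ ∃ i, e ∈ B i) (hd : Pairwise fun i j => Disjoint (B i) (B j))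
    {P : Finset β → Prop} {Q : ι → Finset β → Prop}
    (hP : ∀ R, P R ↔ R ⊆ E ∧ ∀ i, Q i (R ∩ B i)) (R : Finset β) :
    (P R ∧ ∀ R', P R' → R'.card ≤ R.card) ↔
      R ⊆ E ∧ ∀ i, Q i (R ∩ B i) ∧ ∀ S ⊆ B i, Q i S → S.card ≤ (R ∩ B i).card := by
  constructor
  · rintro ⟨hR, hmax⟩
    obtain ⟨hRE, hQ⟩ := (hP R).mp hR
    refine ⟨hRE, fun i => ⟨hQ i, fun S hS hQS => ?_⟩⟩
    -- Exchange argument: replacing the part of `R` in block `i` by `S` leaves all other blocks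
    -- untouched.
    have hi : ((R \ B i) ∪ S) ∩ B i = S := by
      ext e
      have := @hS e
      simp only [Finset.mem_inter, Finset.mem_union, Finset.mem_sdiff]
      tauto
    have hP' : P ((R \ B i) ∪ S) := by
      refine (hP _).mpr ⟨Finset.union_subset (Finset.sdiff_subset.trans hRE)
        fun e he => (hE e).mpr ⟨i, hS he⟩, fun j => ?_⟩
      rcases eq_or_ne j i with rfl | hj
      · rwa [hi]
      · convert hQ j using 1
        ext e
        have h₁ := @hS e
        have h₂ : e ∈ B j → e ∉ B i := fun h => Finset.disjoint_left.mp (hd hj) h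
        simp only [Finset.mem_inter, Finset.mem_union, Finset.mem_sdiff]
        tauto
    have h₁ := hmax _ hP'
    have h₂ := Finset.card_sdiff_add_card_inter R (B i)
    rw [Finset.card_union_of_disjoint (Finset.disjoint_left.mpr fun e he hS' =>
      (Finset.mem_sdiff.mp he).2 (hS hS'))] at h₁
    omega
  · rintro ⟨hRE, h⟩
    refine ⟨(hP R).mpr ⟨hRE, fun i => (h i).1⟩, fun R' hR' => ?_⟩
    obtain ⟨hRE', hQ'⟩ := (hP R').mp hR'
    rw [card_eq_sum_card_inter hE hd hRE, card_eq_sum_card_inter hE hd hRE']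
    exact Finset.sum_le_sum fun i _ => (h i).2 _ Finset.inter_subset_right (hQ' i)

/-- Used for the edges inside a class, with `A` the slack and `T` the tight edges. Only `T` is
constrained, so an optimum contains all of `A`. -/
theorem isMax_inter_iff {B A T : Finset β} (hB : ∀ e, e ∈ B ↔ e ∈ A ∨ e ∈ T)
    (hAT : Disjoint A T) {Q : Finset β → Prop} (hQ : ∀ X, Q X → X ⊆ T) {S : Finset β}
    (hS : S ⊆ B) :
    (Q (S ∩ T) ∧ ∀ S' ⊆ B, Q (S' ∩ T) → S'.card ≤ S.card) ↔
      ∃ X, (Q X ∧ ∀ X', Q X' → X'.card ≤ X.card) ∧ S = A ∪ X := by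
  have hinter : ∀ X ⊆ T, (A ∪ X) ∩ T = X := by
    intro X hX
    ext e
    have h₁ := @hX e
    have h₂ : e ∈ A → e ∉ T := fun h => Finset.disjoint_left.mp hAT h
    simp only [Finset.mem_inter, Finset.mem_union]
    tauto
  have hcard : ∀ X ⊆ T, (A ∪ X).card = A.card + X.card := fun X hX =>
    Finset.card_union_of_disjoint (hAT.mono_right hX)
  have hsub : ∀ S ⊆ B, S ⊆ A ∪ (S ∩ T) := by
    intro S hS e he
    have := hB e |>.mp (hS he)
    simp only [Finset.mem_inter, Finset.mem_union]
    tauto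
  have hAB : ∀ X ⊆ T, A ∪ X ⊆ B := by
    intro X hX e he
    exact (hB e).mpr ((Finset.mem_union.mp he).imp_right (@hX e))
  constructor
  · rintro ⟨h, hmax⟩
    have hle : ∀ X, Q X → A.card + X.card ≤ S.card := by
      intro X hX
      have := hmax (A ∪ X) (hAB X (hQ X hX)) (by rwa [hinter X (hQ X hX)])
      rwa [hcard X (hQ X hX)] at this
    have heq : S = A ∪ (S ∩ T) := by
      refine Finset.eq_of_subset_of_card_le (hsub S hS) ?_
      rw [hcard _ Finset.inter_subset_right]
      exact hle _ h
    have hc := hcard (S ∩ T) Finset.inter_subset_right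
    rw [← heq] at hc
    refine ⟨S ∩ T, ⟨h, fun X' hX' => ?_⟩, heq⟩
    have := hle X' hX'
    omega
  · rintro ⟨X, ⟨hX, hmax⟩, rfl⟩
    rw [hinter X (hQ X hX)]
    refine ⟨hX, fun S' hS' hQ' => (Finset.card_le_card (hsub S' hS')).trans ?_⟩
    rw [hcard _ Finset.inter_subset_right, hcard X (hQ X hX)]
    exact Nat.add_le_add_left (hmax _ hQ') _

/-- Used for the edges between two classes, with `T` the minimizing edges and `p` saying that the
condensation edge is replaceable. An active constraint costs exactly one element of `T`. -/
theorem isMax_imp_not_subset_iff {B T : Finset β} (hTB : T ⊆ B) {p q : Prop}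
    (hpq : q ↔ B.Nonempty ∧ ¬ p)
    {S : Finset β} (hS : S ⊆ B) :
    ((q → ¬ T ⊆ S) ∧ ∀ S' ⊆ B, (q → ¬ T ⊆ S') → S'.card ≤ S.card) ↔
      (p → S = B) ∧ (¬ p → B.Nonempty → ∃ e ∈ T, S = B \ {e}) ∧ (B = ∅ → S = ∅) := by
  have hle := Finset.card_le_card hS
  by_cases hq : q
  · obtain ⟨hB, hnp⟩ := hpq.mp hq
    simp only [hq, hnp, hB, hB.ne_empty, forall_const, false_imp_iff, true_and, not_false_eq_true,
      and_true]
    have hcard : ∀ e ∈ T, (B \ {e}).card + 1 = B.card := fun e he => by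
      rw [← Finset.erase_eq]
      exact Finset.card_erase_add_one (hTB he)
    constructor
    · rintro ⟨h, hmax⟩
      obtain ⟨e, he, heS⟩ := Finset.not_subset.mp h
      refine ⟨e, he, Finset.eq_of_subset_of_card_le ?_ (hmax _ Finset.sdiff_subset fun h => ?_)⟩
      · exact fun f hf => Finset.mem_sdiff.mpr
          ⟨hS hf, fun hfe => heS (Finset.mem_singleton.mp hfe ▸ hf)⟩
      · exact (Finset.mem_sdiff.mp (h he)).2 (Finset.mem_singleton_self e)
    · rintro ⟨e, he, rfl⟩
      refine ⟨fun h => (Finset.mem_sdiff.mp (h he)).2 (Finset.mem_singleton_self e),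
        fun S' hS' h => ?_⟩
      have h₁ : S'.card < B.card := Finset.card_lt_card
        ⟨hS', fun hBS => h (hTB.trans hBS)⟩
      have h₂ := hcard e he
      omega
  · simp only [hq, false_imp_iff, forall_const, true_and]
    have hB : B.Nonempty → p := fun hB => by_contra fun hp => hq (hpq.mpr ⟨hB, hp⟩)
    constructor
    · intro hmax
      have : S = B := Finset.eq_of_subset_of_card_le hS (hmax B subset_rfl)
      exact ⟨fun _ => this, fun h h' => absurd (hB h') h, fun h => this.trans h⟩
    · rintro ⟨h₁, -, h₂⟩ S' hS'
      rcases B.eq_empty_or_nonempty with h | h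
      · rw [h₂ h]
        rw [h] at hS'
        exact Finset.card_le_card hS'
      · rw [h₁ (hB h)]
        exact Finset.card_le_card hS'

end Blocks

/-! ### Graphs whose nontrivial closed walks are all positive. -/

section Acyclic

open Classical in
/-- The edges that can be replaced by a walk, of no greater weight, with at least two edges. -/
noncomputable def replaceable {α : Type*} (G : WDigraph α) : Finset (α × α) :=
  G.edges.filter fun e => ∃ n ≥ 2, ∃ r ≤ G.weight e, HasWalk G.weight G.edges e.1 e.2 n r

variable {α : Type*} {G : WDigraph α}

open Classical in
theorem mem_replaceable {e : α × α} : e ∈ G.replaceable ↔ e ∈ G.edges ∧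
    ∃ n ≥ 2, ∃ r ≤ G.weight e, HasWalk G.weight G.edges e.1 e.2 n r := by
  rw [replaceable, Finset.mem_filter]

/-- The walk replacing a deleted edge avoids that edge and joins distinct nodes, so it has at least
two edges; thus every redundant set lies in `G.replaceable`. This set is itself redundant by
`preserves_sdiff_of_pos`. -/
theorem isMaxRedundant_iff_eq_replaceable [DecidableEq α]
    (hpos : ∀ u n r, HasWalk G.weight G.edges u u (n + 1) r → 0 < r) (R : Finset (α × α)) :
    G.IsMaxRedundant R ↔ R = G.replaceable := by
  have hG : NoNeg G.weight G.edges := by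
    rintro u r ⟨n, hr⟩
    cases n with
    | zero => cases hr; exact le_rfl
    | succ n => exact (hpos u n r hr).le
  have hred : G.IsRedundant G.replaceable := (isRedundant_iff hG).mpr
    ⟨fun _ he => (mem_replaceable.mp he).1, preserves_sdiff_of_pos G.edge_ne hpos _
      fun e he => (mem_replaceable.mp he).2⟩
  have hsub : ∀ R, G.IsRedundant R → R ⊆ G.replaceable := by
    intro R hR e he
    obtain ⟨hRE, hP⟩ := (isRedundant_iff hG).mp hR
    refine mem_replaceable.mpr ⟨hRE he, ?_⟩
    obtain ⟨r, hr, n, hn⟩ := hP e (hRE he)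
    refine ⟨n, ?_, r, hr, hn.mono Set.sdiff_subset⟩
    obtain ⟨x, y⟩ := e
    by_contra hlt
    have : n = 0 ∨ n = 1 := by omega
    rcases this with rfl | rfl
    · cases hn
      exact G.edge_ne _ (hRE he) rfl
    · cases hn with
      | cons h hp =>
        cases hp
        exact h.2 he
  constructor
  · rintro ⟨hR, hmax⟩
    exact Finset.eq_of_subset_of_card_le (hsub R hR) (hmax _ hred)
  · rintro rfl
    exact ⟨hred, fun R' hR' => Finset.card_le_card (hsub R' hR')⟩

end Acyclic

/-! ### Distances and tight edges inside a class. -/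

section Classes

variable {α : Type*} {G : WDigraph α} {i j k x y : α} {n : ℕ} {r s : ℝ}

theorem ZeroRel.refl {c : α × α → ℝ} {E : Set (α × α)} (i : α) : ZeroRel c E i i :=
  ⟨0, .refl i, by simpa using Reach.refl i⟩

theorem ZeroRel.symm {c : α × α → ℝ} {E : Set (α × α)} (h : ZeroRel c E i j) :
    ZeroRel c E j i := by
  obtain ⟨r, h₁, h₂⟩ := h
  exact ⟨-r, h₂, by simpa using h₁⟩

theorem ZeroRel.trans {c : α × α → ℝ} {E : Set (α × α)} (h : ZeroRel c E i j)
    (h' : ZeroRel c E j k) : ZeroRel c E i k := by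
  obtain ⟨r, h₁, h₂⟩ := h
  obtain ⟨s, h₃, h₄⟩ := h'
  refine ⟨r + s, h₁.trans h₃, ?_⟩
  convert h₄.trans h₂ using 1
  ring

theorem minWeight_le (hG : NoNeg G.weight G.edges) (hi : i ∈ G.nodes)
    (h : Reach G.weight G.edges i j r) : G.minWeight i j ≤ r :=
  (minWeight_isLeast hG hi h).2

/-- The two distances sum to at most r + (-r), and to at least 0 because they close up to a walk.
This cancellation makes detours within a class free. -/
theorem ZeroRel.minWeight (hG : NoNeg G.weight G.edges) (hi : i ∈ G.nodes)
    (h : ZeroRel G.weight G.edges i j) :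
    Reach G.weight G.edges i j (G.minWeight i j) ∧
      Reach G.weight G.edges j i (G.minWeight j i) ∧
      G.minWeight i j + G.minWeight j i = 0 := by
  obtain ⟨r, h₁, h₂⟩ := h
  obtain ⟨h₃, h₄⟩ := minWeight_isLeast hG hi h₁
  obtain ⟨h₅, h₆⟩ := minWeight_isLeast hG (h₁.mem_nodes hi) h₂
  have := hG _ _ (h₃.trans h₅)
  exact ⟨h₃, h₅, by linarith⟩

open Classical in
theorem mem_zeroClass : i ∈ G.zeroClass x ↔ i ∈ G.nodes ∧ ZeroRel G.weight G.edges i x := by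
  rw [zeroClass, Finset.mem_filter]
  exact and_congr_right fun h => zeroEquiv_iff h

open Classical in
theorem mem_edgesBetween {e : α × α} : e ∈ G.edgesBetween x y ↔
    e ∈ G.edges ∧ e.1 ∈ G.zeroClass x ∧ e.2 ∈ G.zeroClass y := by
  rw [edgesBetween, Finset.mem_filter]

theorem mem_intraTight {e : α × α} : e ∈ G.intraTight x ↔
    e ∈ G.edgesBetween x x ∧ G.weight e = G.minWeight e.1 e.2 := by
  rw [intraTight, Finset.mem_filter]

theorem intraTight_subset : G.intraTight x ⊆ G.edges := fun _ he =>
  (mem_edgesBetween.mp (mem_intraTight.mp he).1).1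

theorem mem_edgesBetween_self_iff (hG : NoNeg G.weight G.edges) {e : α × α} :
    e ∈ G.edgesBetween x x ↔ e ∈ G.intraSlack x ∨ e ∈ G.intraTight x := by
  rw [intraSlack, mem_intraTight, Finset.mem_filter, ← and_or_left]
  refine ⟨fun h => ⟨h, ?_⟩, fun h => h.1⟩
  have he := (mem_edgesBetween.mp h).1
  rcases (minWeight_le hG (G.edge_nodes e he).1 (Reach.edge he)).lt_or_eq with h | h
  · exact .inl h
  · exact .inr h.symm

theorem disjoint_intraSlack_intraTight : Disjoint (G.intraSlack x) (G.intraTight x) :=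
  Finset.disjoint_left.mpr fun _ h h' =>
    (Finset.mem_filter.mp h).2.ne (Finset.mem_filter.mp h').2.symm

/-- A shortest walk between two equivalent nodes consists of tight edges of their class. -/
theorem HasWalk.inter_intraTight (hG : NoNeg G.weight G.edges) {H : Set (α × α)}
    (hH : H ⊆ G.edges) (h : HasWalk G.weight H i j n r) (hi : i ∈ G.zeroClass x)
    (hij : ZeroRel G.weight G.edges i j) (hr : r ≤ G.minWeight i j) :
    HasWalk G.weight (H ∩ G.intraTight x) i j n r := by
  induction h with
  | nil u => exact .nil u
  | @cons i z j n r h hp ih =>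
    obtain ⟨hin, hix⟩ := mem_zeroClass.mp hi
    have hzn := (G.edge_nodes _ (hH h)).2
    obtain ⟨-, hji, hd⟩ := hij.minWeight hG hin
    -- Closing the walk with a shortest walk from `j` to `i` gives weight at most 0, hence exactly
    -- 0, so the next node `z` is in the same class.
    have hzi : Reach G.weight G.edges z i (r + G.minWeight j i) :=
      Reach.trans ⟨n, hp.mono hH⟩ hji
    have hiz := Reach.edge (c := G.weight) (hH h)
    have h₀ := hG _ _ (hiz.trans hzi)
    have hiz' : ZeroRel G.weight G.edges i z :=
      ⟨_, hiz, by convert hzi using 1; linarith⟩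
    obtain ⟨h₁, -, h₂⟩ := hiz'.minWeight hG hin
    have h₃ := minWeight_le hG hin hiz
    have h₄ := minWeight_le hG hzn hzi
    have hzj := hiz'.symm.trans hij
    have h₅ := minWeight_le hG hin (h₁.trans (hzj.minWeight hG hzn).1)
    have hz : z ∈ G.zeroClass x := mem_zeroClass.mpr ⟨hzn, hiz'.symm.trans hix⟩
    refine .cons ⟨h, ?_⟩ (ih hz hzj (by linarith))
    exact mem_intraTight.mpr ⟨mem_edgesBetween.mpr ⟨hH h, hi, hz⟩, by
      show G.weight (i, z) = G.minWeight i z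
      linarith⟩

theorem isRedundant_tightSubgraph_iff [DecidableEq α] (hG : NoNeg G.weight G.edges)
    {S : Finset (α × α)} : (G.tightSubgraph x).IsRedundant S ↔ S ⊆ G.intraTight x ∧
      Preserves G.weight ((G.intraTight x : Set (α × α)) \ S) (G.intraTight x) :=
  isRedundant_iff (G := G.tightSubgraph x) (hG.mono intraTight_subset)

end Classes

/-! ### Projecting walks to the condensation and lifting them back. -/

section Condensation

variable {α : Type*} {G : WDigraph α} {K : ℕ} {v : Fin K → α} {i j k : Fin K} {x y z : α}
  {n : ℕ} {r : ℝ} {e : α × α}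

theorem IsClassReps.mem_zeroClass_self (hv : G.IsClassReps v) (k : Fin K) :
    v k ∈ G.zeroClass (v k) :=
  mem_zeroClass.mpr ⟨hv.1 k, .refl _⟩

open Classical in
theorem IsClassReps.eq_of_mem (hv : G.IsClassReps v) (hi : x ∈ G.zeroClass (v i))
    (hj : x ∈ G.zeroClass (v j)) : i = j :=
  (hv.2 x (Finset.mem_filter.mp hi).1).unique (Finset.mem_filter.mp hi).2
    (Finset.mem_filter.mp hj).2

open Classical in
theorem IsClassReps.exists_mem (hv : G.IsClassReps v) (hx : x ∈ G.nodes) :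
    ∃ k, x ∈ G.zeroClass (v k) :=
  (hv.2 x hx).exists.imp fun _ hk => Finset.mem_filter.mpr ⟨hx, hk⟩

theorem IsClassReps.injective (hv : G.IsClassReps v) : Function.Injective v := fun i j h =>
  hv.eq_of_mem (hv.mem_zeroClass_self i) (h ▸ hv.mem_zeroClass_self j)

open Classical in
theorem exists_of_mem_condensation_edges (he : e ∈ (G.condensation v).edges) :
    ∃ i j, e = (v i, v j) ∧ v i ≠ v j ∧ (G.edgesBetween (v i) (v j)).Nonempty := by
  obtain ⟨h₁, h₂, h₃⟩ := Finset.mem_filter.mp he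
  obtain ⟨h₄, h₅⟩ := Finset.mem_product.mp h₁
  obtain ⟨i, -, hi⟩ := Finset.mem_image.mp h₄
  obtain ⟨j, -, hj⟩ := Finset.mem_image.mp h₅
  obtain ⟨a, b⟩ := e
  obtain rfl : v i = a := hi
  obtain rfl : v j = b := hj
  exact ⟨i, j, rfl, h₂, h₃⟩

open Classical in
theorem mem_condensation_edges (hij : v i ≠ v j)
    (h : (G.edgesBetween (v i) (v j)).Nonempty) : (v i, v j) ∈ (G.condensation v).edges :=
  Finset.mem_filter.mpr ⟨Finset.mem_product.mpr
    ⟨Finset.mem_image_of_mem v (Finset.mem_univ i), Finset.mem_image_of_mem v (Finset.mem_univ j)⟩,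
    hij, h⟩

open Classical in
theorem mem_condensation_edges_iff (hv : G.IsClassReps v) (hij : i ≠ j) :
    (v i, v j) ∈ (G.condensation v).edges ↔ (G.edgesBetween (v i) (v j)).Nonempty :=
  ⟨fun h => (Finset.mem_filter.mp h).2.2, mem_condensation_edges (hv.injective.ne hij)⟩

theorem condensation_weight (h : (G.edgesBetween x y).Nonempty) :
    (G.condensation v).weight (x, y) = (G.edgesBetween x y).inf' h (G.viaWeight x y) :=
  dif_pos h

theorem condensation_weight_le (he : e ∈ G.edgesBetween x y) :
    (G.condensation v).weight (x, y) ≤ G.viaWeight x y e := by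
  rw [condensation_weight ⟨e, he⟩]
  exact Finset.inf'_le _ he

theorem interTight_subset : G.interTight x y ⊆ G.edgesBetween x y :=
  Finset.filter_subset _ _

theorem mem_interTight_iff (v : Fin K → α) : e ∈ G.interTight x y ↔
    e ∈ G.edgesBetween x y ∧ G.viaWeight x y e ≤ (G.condensation v).weight (x, y) := by
  rw [interTight, Finset.mem_filter]
  refine and_congr_right fun he => ?_
  have hne : (G.edgesBetween x y).Nonempty := ⟨e, he⟩
  rw [condensation_weight hne, Finset.le_inf'_iff]

theorem interTight_nonempty (h : (G.edgesBetween x y).Nonempty) :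
    (G.interTight x y).Nonempty := by
  obtain ⟨e, he, hmin⟩ := Finset.exists_min_image _ (G.viaWeight x y) h
  exact ⟨e, Finset.mem_filter.mpr ⟨he, hmin⟩⟩

theorem reach_of_mem_interTight (hG : NoNeg G.weight G.edges)
    (he : e ∈ G.interTight x y) :
    Reach G.weight G.edges x y (G.viaWeight x y e) := by
  obtain ⟨h, h₁, h₂⟩ := mem_edgesBetween.mp (interTight_subset he)
  obtain ⟨-, h₃, -⟩ := (mem_zeroClass.mp h₁).2.minWeight hG (mem_zeroClass.mp h₁).1
  obtain ⟨h₄, -, -⟩ := (mem_zeroClass.mp h₂).2.minWeight hG (mem_zeroClass.mp h₂).1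
  exact (h₃.trans (Reach.edge (Finset.mem_coe.mpr h))).trans h₄

theorem viaWeight_eq_of_mem_interTight (v : Fin K → α) (he : e ∈ G.interTight x y) :
    G.viaWeight x y e = (G.condensation v).weight (x, y) :=
  le_antisymm ((mem_interTight_iff v).mp he).2 (condensation_weight_le (interTight_subset he))

theorem reach_of_reach_condensation (hG : NoNeg G.weight G.edges)
    (h : Reach (G.condensation v).weight (G.condensation v).edges x y r) :
    Reach G.weight G.edges x y r := by
  obtain ⟨n, h⟩ := h
  induction h with
  | nil u => exact .refl u
  | cons h _ ih =>
    obtain ⟨i, j, hij, -, hne⟩ := exists_of_mem_condensation_edges h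
    obtain ⟨rfl, rfl⟩ := Prod.mk.inj hij
    obtain ⟨e, he⟩ := interTight_nonempty hne
    rw [← viaWeight_eq_of_mem_interTight v he]
    exact (reach_of_mem_interTight hG he).trans ih

/-- A nontrivial closed walk of weight zero would lift to `G` and make the ends of its first edge
equivalent, yet these represent different classes. -/
theorem condensation_closed_pos (hG : NoNeg G.weight G.edges) (hv : G.IsClassReps v)
    (h : HasWalk (G.condensation v).weight (G.condensation v).edges x x (n + 1) r) :
    0 < r := by
  have h₀ := hG _ _ (reach_of_reach_condensation hG ⟨_, h⟩)
  refine h₀.lt_of_ne' fun hr => ?_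
  cases h with
  | @cons _ y _ _ r h hp =>
    obtain ⟨i, j, hij, hne, -⟩ := exists_of_mem_condensation_edges h
    obtain ⟨rfl, rfl⟩ := Prod.mk.inj hij
    have h₁ := reach_of_reach_condensation hG ⟨_, hp⟩
    have h₂ := reach_of_reach_condensation hG (.edge h)
    have hz : ZeroRel G.weight G.edges (v i) (v j) :=
      ⟨_, h₂, by convert h₁ using 1; linarith⟩
    exact hne (congrArg v (hv.eq_of_mem (hv.mem_zeroClass_self i)
      (mem_zeroClass.mpr ⟨hv.1 i, hz⟩)))

/-- A walk of `G` projects to a walk of the condensation; if the latter is a single edge, then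
the former traverses an edge between the two classes. -/
theorem HasWalk.project (hG : NoNeg G.weight G.edges) (hv : G.IsClassReps v)
    {H : Set (α × α)} (hH : H ⊆ G.edges) (h : HasWalk G.weight H x y n r)
    (hx : x ∈ G.zeroClass (v i)) (hy : y ∈ G.zeroClass (v j)) :
    ∃ m s, HasWalk (G.condensation v).weight (G.condensation v).edges (v i) (v j) m s ∧
      s ≤ G.minWeight (v i) x + r + G.minWeight y (v j) ∧
      (m = 1 → ∃ e ∈ H, e ∈ G.edgesBetween (v i) (v j) ∧
        G.viaWeight (v i) (v j) e ≤ G.minWeight (v i) x + r + G.minWeight y (v j)) := by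
  induction h generalizing i with
  | nil x =>
    obtain rfl := hv.eq_of_mem hx hy
    have := ((mem_zeroClass.mp hx).2.minWeight hG (mem_zeroClass.mp hx).1).2.2
    exact ⟨0, 0, .nil _, by linarith, by simp⟩
  | @cons x z y n r h hp ih =>
    have hE := hH h
    have hzn := (G.edge_nodes _ hE).2
    obtain ⟨k, hk⟩ := hv.exists_mem hzn
    obtain ⟨m, s, hw, hs, hm⟩ := ih hk hy
    by_cases hik : i = k
    · subst hik
      obtain ⟨-, hx', -⟩ := (mem_zeroClass.mp hx).2.minWeight hG (mem_zeroClass.mp hx).1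
      -- An edge inside the class is absorbed into the distance from the representative.
      have hle := minWeight_le hG (hv.1 i) (hx'.trans (.edge hE))
      refine ⟨m, s, hw, by linarith, fun h1 => ?_⟩
      obtain ⟨e, he, he', hle'⟩ := hm h1
      exact ⟨e, he, he', by linarith⟩
    · have hb : (x, z) ∈ G.edgesBetween (v i) (v k) := mem_edgesBetween.mpr ⟨hE, hx, hk⟩
      have h₁ : (G.condensation v).weight (v i, v k) ≤
          G.minWeight (v i) x + G.weight (x, z) + G.minWeight z (v k) :=
        condensation_weight_le hb
      -- The detour from `z` to `v k` and back has weight 0.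
      have h₂ := ((mem_zeroClass.mp hk).2.minWeight hG hzn).2.2
      refine ⟨m + 1, _, .cons (mem_condensation_edges (hv.injective.ne hik) ⟨_, hb⟩) hw,
        by linarith, fun h1 => ⟨(x, z), h, ?_⟩⟩
      obtain rfl : m = 0 := by omega
      have hkj : k = j ∧ s = 0 := by
        generalize hvk : v k = a at hw
        generalize hvj : v j = b at hw
        cases hw
        exact ⟨hv.injective (hvk.trans hvj.symm), rfl⟩
      obtain ⟨rfl, rfl⟩ := hkj
      refine ⟨hb, ?_⟩
      show G.minWeight (v i) x + G.weight (x, z) + G.minWeight z (v k) ≤ _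
      linarith

/-- Redundancy is decided class by class and, between two classes, by a single edge of the
condensation. -/
theorem preserves_iff [DecidableEq α] (hG : NoNeg G.weight G.edges) (hv : G.IsClassReps v)
    {H : Set (α × α)} (hH : H ⊆ G.edges) : Preserves G.weight H G.edges ↔
      (∀ k, Preserves G.weight (H ∩ G.intraTight (v k)) (G.intraTight (v k))) ∧
      ∀ i j, (v i, v j) ∈ (G.condensation v).edges →
        (v i, v j) ∉ (G.condensation v).replaceable →
        ∃ e ∈ H, e ∈ G.interTight (v i) (v j) := by
  constructor
  · intro hP
    refine ⟨fun k e he => ?_, fun i j hij hR => ?_⟩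
    · obtain ⟨hb, hd⟩ := mem_intraTight.mp he
      obtain ⟨hE, h₁, h₂⟩ := mem_edgesBetween.mp hb
      obtain ⟨r, hr, n, hn⟩ := hP e hE
      exact ⟨r, hr, n, hn.inter_intraTight hG hH h₁
        ((mem_zeroClass.mp h₁).2.trans (mem_zeroClass.mp h₂).2.symm) (hr.trans_eq hd)⟩
    · obtain ⟨i', j', hij', -, hne⟩ := exists_of_mem_condensation_edges hij
      rw [Prod.mk.injEq] at hij'
      rw [← hij'.1, ← hij'.2] at hne
      -- The replacement in `H` of a minimizing edge projects to a walk no heavier than the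
      -- condensation edge. Distinct ends exclude length 0 and irreplaceability excludes length at
      -- least 2; length 1 exhibits a minimizing edge in `H`.
      obtain ⟨e, he⟩ := interTight_nonempty hne
      obtain ⟨hb, hvia⟩ := (mem_interTight_iff v).mp he
      obtain ⟨hE, h₁, h₂⟩ := mem_edgesBetween.mp hb
      obtain ⟨r, hr, n, hn⟩ := hP e hE
      obtain ⟨m, s, hw, hs, hm⟩ := hn.project hG hv hH h₁ h₂
      have hle : G.minWeight (v i) e.1 + r + G.minWeight e.2 (v j) ≤
          (G.condensation v).weight (v i, v j) := by
        unfold viaWeight at hvia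
        linarith
      have hm1 : m = 1 := by
        by_contra hm1
        rcases m with _ | _ | m
        · exfalso
          have hne' := (G.condensation v).edge_ne _ hij
          simp only at hne'
          generalize v i = a at hw hne'
          generalize v j = b at hw hne'
          cases hw
          exact hne' rfl
        · exact hm1 rfl
        · exact hR (mem_replaceable.mpr ⟨hij, m + 2, by omega, s, hs.trans hle, hw⟩)
      obtain ⟨f, hf, hfb, hfw⟩ := hm hm1
      exact ⟨f, hf, (mem_interTight_iff v).mpr ⟨hfb, hfw.trans hle⟩⟩
  · rintro ⟨hin, hout⟩
    have hintra : ∀ k x y, x ∈ G.zeroClass (v k) → y ∈ G.zeroClass (v k) →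
        ∃ r ≤ G.minWeight x y, Reach G.weight H x y r := by
      intro k x y hx hy
      have hxy := (mem_zeroClass.mp hx).2.trans (mem_zeroClass.mp hy).2.symm
      obtain ⟨⟨n, hn⟩, -, -⟩ := hxy.minWeight hG (mem_zeroClass.mp hx).1
      have := hn.inter_intraTight hG subset_rfl hx hxy le_rfl
      obtain ⟨r, hr, hw⟩ := (hin k).reach ⟨n, this.mono Set.inter_subset_right⟩
      exact ⟨r, hr, hw.mono Set.inter_subset_left⟩
    have hcond := preserves_sdiff_of_pos (G.condensation v).edge_ne
      (fun u n r => condensation_closed_pos hG hv) (G.condensation v).replaceable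
      fun e he => (mem_replaceable.mp he).2
    -- Each remaining condensation edge is realized in `H` by a minimizing edge, joined to the
    -- representatives by shortest walks within the two classes.
    have hlift : ∀ {x y r}, Reach (G.condensation v).weight
        ((G.condensation v).edges \ (G.condensation v).replaceable) x y r →
        ∃ s ≤ r, Reach G.weight H x y s := by
      rintro x y r ⟨n, hn⟩
      induction hn with
      | nil u => exact ⟨0, le_rfl, .refl u⟩
      | cons h _ ih =>
        obtain ⟨s, hs, hw⟩ := ih
        obtain ⟨i, j, hij, -, -⟩ := exists_of_mem_condensation_edges h.1
        obtain ⟨rfl, rfl⟩ := Prod.mk.inj hij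
        obtain ⟨e, heH, he⟩ := hout i j h.1 h.2
        rw [← viaWeight_eq_of_mem_interTight v he]
        obtain ⟨-, h₁, h₂⟩ := mem_edgesBetween.mp (interTight_subset he)
        obtain ⟨r₁, hr₁, hw₁⟩ := hintra i _ _ (hv.mem_zeroClass_self i) h₁
        obtain ⟨r₂, hr₂, hw₂⟩ := hintra j _ _ h₂ (hv.mem_zeroClass_self j)
        refine ⟨_, ?_, ((hw₁.trans (.edge heH)).trans hw₂).trans hw⟩
        unfold viaWeight
        linarith
    intro e he
    obtain ⟨hn₁, hn₂⟩ := G.edge_nodes e he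
    obtain ⟨i, hi⟩ := hv.exists_mem hn₁
    obtain ⟨j, hj⟩ := hv.exists_mem hn₂
    by_cases hij : i = j
    · subst hij
      obtain ⟨r, hr, hw⟩ := hintra i _ _ hi hj
      exact ⟨r, hr.trans (minWeight_le hG hn₁ (.edge he)), hw⟩
    · have hb : e ∈ G.edgesBetween (v i) (v j) := mem_edgesBetween.mpr ⟨he, hi, hj⟩
      obtain ⟨r, hr, hw⟩ := hcond _ (mem_condensation_edges (hv.injective.ne hij) ⟨e, hb⟩)
      obtain ⟨s, hs, hw⟩ := hlift hw
      have hle : (G.condensation v).weight (v i, v j) ≤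
          G.minWeight (v i) e.1 + G.weight e + G.minWeight e.2 (v j) :=
        condensation_weight_le hb
      obtain ⟨r₁, hr₁, hw₁⟩ := hintra i _ _ hi (hv.mem_zeroClass_self i)
      obtain ⟨r₂, hr₂, hw₂⟩ := hintra j _ _ (hv.mem_zeroClass_self j) hj
      -- The replacement runs e.1 → v i → v j → e.2; the distances to and from the representatives
      -- cancel, leaving at most the weight of `e`.
      have h₁ := ((mem_zeroClass.mp hi).2.minWeight hG hn₁).2.2
      have h₂ := ((mem_zeroClass.mp hj).2.minWeight hG hn₂).2.2
      exact ⟨_, by linarith, (hw₁.trans hw).trans hw₂⟩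

end Condensation

/-! ### Redundancy and maximality block by block. -/

section MaxRedundant

variable {α : Type*} {G : WDigraph α} {K : ℕ} {v : Fin K → α}

theorem mem_edges_iff_exists_block (hv : G.IsClassReps v) (e : α × α) :
    e ∈ G.edges ↔ ∃ q : Fin K × Fin K, e ∈ G.edgesBetween (v q.1) (v q.2) := by
  refine ⟨fun he => ?_, fun ⟨_, h⟩ => (mem_edgesBetween.mp h).1⟩
  obtain ⟨h₁, h₂⟩ := G.edge_nodes e he
  obtain ⟨i, hi⟩ := hv.exists_mem h₁
  obtain ⟨j, hj⟩ := hv.exists_mem h₂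
  exact ⟨(i, j), mem_edgesBetween.mpr ⟨he, hi, hj⟩⟩

theorem eq_of_mem_blocks (hv : G.IsClassReps v) {e : α × α} {q q' : Fin K × Fin K}
    (h : e ∈ G.edgesBetween (v q.1) (v q.2)) (h' : e ∈ G.edgesBetween (v q'.1) (v q'.2)) :
    q = q' :=
  Prod.ext (hv.eq_of_mem (mem_edgesBetween.mp h).2.1 (mem_edgesBetween.mp h').2.1)
    (hv.eq_of_mem (mem_edgesBetween.mp h).2.2 (mem_edgesBetween.mp h').2.2)

theorem pairwise_disjoint_blocks (hv : G.IsClassReps v) :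
    Pairwise fun q q' : Fin K × Fin K =>
      Disjoint (G.edgesBetween (v q.1) (v q.2)) (G.edgesBetween (v q'.1) (v q'.2)) :=
  fun _ _ hne => Finset.disjoint_left.mpr fun _ h h' => hne (eq_of_mem_blocks hv h h')

variable [DecidableEq α]

/-- The condition that a redundant edge set satisfies on the edges from the class of `v i` to the
class of `v j`, which are the second argument. -/
def BlockCondition (G : WDigraph α) (v : Fin K → α) (q : Fin K × Fin K)
    (S : Finset (α × α)) : Prop :=
  if q.1 = q.2 then (G.tightSubgraph (v q.1)).IsRedundant (S ∩ G.intraTight (v q.1))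
  else (v q.1, v q.2) ∈ (G.condensation v).edges ∧
    (v q.1, v q.2) ∉ (G.condensation v).replaceable → ¬ G.interTight (v q.1) (v q.2) ⊆ S

/-- `preserves_iff` is applied to E \ R, where retaining a minimizing edge means that `R` does not
contain all of them. Each condition depends only on the part of `R` in one block. -/
theorem isRedundant_iff_blockCondition (hG : NoNeg G.weight G.edges) (hv : G.IsClassReps v)
    (R : Finset (α × α)) : G.IsRedundant R ↔
      R ⊆ G.edges ∧ ∀ q, G.BlockCondition v q (R ∩ G.edgesBetween (v q.1) (v q.2)) := by
  rw [isRedundant_iff hG]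
  refine and_congr_right fun hR => ?_
  rw [preserves_iff hG hv Set.sdiff_subset]
  have hdiag : ∀ k, (G.BlockCondition v (k, k) (R ∩ G.edgesBetween (v k) (v k)) ↔
      Preserves G.weight (((G.edges : Set (α × α)) \ R) ∩ G.intraTight (v k))
        (G.intraTight (v k))) := by
    intro k
    rw [BlockCondition, if_pos rfl, isRedundant_tightSubgraph_iff hG,
      and_iff_right Finset.inter_subset_right]
    have : ((G.intraTight (v k) : Set (α × α)) \
        ((R ∩ G.edgesBetween (v k) (v k) ∩ G.intraTight (v k) : Finset (α × α)) :
          Set (α × α))) = ((G.edges : Set (α × α)) \ R) ∩ G.intraTight (v k) := by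
      ext e
      have h₁ := @intraTight_subset _ G (v k) e
      have h₂ : e ∈ G.intraTight (v k) → e ∈ G.edgesBetween (v k) (v k) :=
        fun h => (mem_intraTight.mp h).1
      simp only [Set.mem_sdiff, Set.mem_inter_iff, Finset.mem_coe, Finset.mem_inter]
      tauto
    exact iff_of_eq (congrArg (fun H => Preserves G.weight H _) this)
  constructor
  · rintro ⟨hin, hout⟩ ⟨i, j⟩
    by_cases hij : i = j
    · subst hij
      exact (hdiag i).mpr (hin i)
    · rw [BlockCondition, if_neg hij]
      rintro ⟨h₁, h₂⟩ hsub
      obtain ⟨e, he, het⟩ := hout i j h₁ h₂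
      exact he.2 (Finset.mem_inter.mp (hsub het)).1
  · refine fun h => ⟨fun k => (hdiag k).mp (h (k, k)), fun i j h₁ h₂ => ?_⟩
    have hij : i ≠ j := fun hij =>
      (G.condensation v).edge_ne _ h₁ (congrArg v hij)
    have := h (i, j)
    rw [BlockCondition, if_neg hij] at this
    obtain ⟨e, he, heR⟩ := Finset.not_subset.mp (this ⟨h₁, h₂⟩)
    have hb := interTight_subset he
    exact ⟨e, ⟨(mem_edgesBetween.mp hb).1, fun h => heR (Finset.mem_inter.mpr ⟨h, hb⟩)⟩, he⟩

/-- The shape that a maximum redundant edge set has on the edges from the class of `v i` to the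
class of `v j`. -/
def BlockShape (G : WDigraph α) (v : Fin K → α) (q : Fin K × Fin K)
    (S : Finset (α × α)) : Prop :=
  if q.1 = q.2 then
    ∃ X, (G.tightSubgraph (v q.1)).IsMaxRedundant X ∧ S = G.intraSlack (v q.1) ∪ X
  else ((v q.1, v q.2) ∈ (G.condensation v).replaceable → S = G.edgesBetween (v q.1) (v q.2)) ∧
    ((v q.1, v q.2) ∉ (G.condensation v).replaceable →
      (G.edgesBetween (v q.1) (v q.2)).Nonempty →
      ∃ e ∈ G.interTight (v q.1) (v q.2), S = G.edgesBetween (v q.1) (v q.2) \ {e}) ∧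
    (G.edgesBetween (v q.1) (v q.2) = ∅ → S = ∅)

theorem isMax_blockCondition_iff (hG : NoNeg G.weight G.edges) (hv : G.IsClassReps v)
    (q : Fin K × Fin K) {S : Finset (α × α)} (hS : S ⊆ G.edgesBetween (v q.1) (v q.2)) :
    (G.BlockCondition v q S ∧ ∀ S' ⊆ G.edgesBetween (v q.1) (v q.2),
      G.BlockCondition v q S' → S'.card ≤ S.card) ↔ G.BlockShape v q S := by
  obtain ⟨i, j⟩ := q
  by_cases hij : i = j
  · subst hij
    simp only [BlockCondition, BlockShape, if_true]
    exact isMax_inter_iff (fun e => mem_edgesBetween_self_iff hG)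
      disjoint_intraSlack_intraTight
      (fun X hX => ((isRedundant_tightSubgraph_iff hG).mp hX).1) hS
  · simp only [BlockCondition, BlockShape, hij, if_false]
    exact isMax_imp_not_subset_iff interTight_subset
      (and_congr_left' (mem_condensation_edges_iff hv hij)) hS

theorem BlockShape.subset (hG : NoNeg G.weight G.edges) {q : Fin K × Fin K}
    {S : Finset (α × α)} (h : G.BlockShape v q S) : S ⊆ G.edgesBetween (v q.1) (v q.2) := by
  obtain ⟨i, j⟩ := q
  unfold BlockShape at h
  split_ifs at h with hij
  · obtain rfl : i = j := hij
    obtain ⟨X, hX, rfl⟩ := h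
    intro e he
    exact (mem_edgesBetween_self_iff hG).mpr ((Finset.mem_union.mp he).imp_right
      fun h => ((isRedundant_tightSubgraph_iff hG).mp hX.1).1 h)
  · rcases (G.edgesBetween (v i) (v j)).eq_empty_or_nonempty with h₀ | h₀
    · exact (h.2.2 h₀).trans_subset (Finset.empty_subset _)
    · by_cases hR : (v i, v j) ∈ (G.condensation v).replaceable
      · exact (h.1 hR).subset
      · obtain ⟨e, -, he⟩ := h.2.1 hR h₀
        exact he.trans_subset Finset.sdiff_subset

/-- The maximum redundant edge sets are the unions of sets of the right shape, one for each
ordered pair of classes. -/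
theorem isMaxRedundant_iff_exists_blockShape (hG : NoNeg G.weight G.edges)
    (hv : G.IsClassReps v) (R : Finset (α × α)) : G.IsMaxRedundant R ↔
      ∃ S : Fin K × Fin K → Finset (α × α), (∀ q, G.BlockShape v q (S q)) ∧
        R = Finset.univ.biUnion S := by
  rw [IsMaxRedundant, isMax_iff_forall_block (mem_edges_iff_exists_block hv)
    (pairwise_disjoint_blocks hv) (isRedundant_iff_blockCondition hG hv)]
  simp only [isMax_blockCondition_iff hG hv _ Finset.inter_subset_right]
  constructor
  · rintro ⟨hR, h⟩
    refine ⟨_, h, ?_⟩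
    rw [← Finset.inter_biUnion, eq_comm, Finset.inter_eq_left]
    intro e he
    obtain ⟨q, hq⟩ := (mem_edges_iff_exists_block hv e).mp (hR he)
    exact Finset.mem_biUnion.mpr ⟨q, Finset.mem_univ q, hq⟩
  · rintro ⟨S, hS, rfl⟩
    refine ⟨fun e he => ?_, fun q => ?_⟩
    · obtain ⟨q, -, hq⟩ := Finset.mem_biUnion.mp he
      exact (mem_edges_iff_exists_block hv e).mpr ⟨q, (hS q).subset hG hq⟩
    -- The blocks are disjoint, so intersecting the union with block `q` recovers `S q`.
    · convert hS q using 1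
      ext e
      simp only [Finset.mem_inter, Finset.mem_biUnion, Finset.mem_univ, true_and]
      refine ⟨fun ⟨⟨q', h⟩, hb⟩ => ?_, fun h => ⟨⟨q, h⟩, (hS q).subset hG h⟩⟩
      exact eq_of_mem_blocks hv ((hS q').subset hG h) hb ▸ h

end MaxRedundant

end WDigraph

/-! ### The main theorem: diagonal and off-diagonal blocks put in the stated form. -/

open WDigraph in
theorem mainTheorem3 {α : Type*} [DecidableEq α] (G : WDigraph α) (hG : G.NoNegClosedWalk)
    {K : ℕ} (v : Fin K → α) (hv : G.IsClassReps v) :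
    (∃! Rt : Finset (α × α), (G.condensation v).IsMaxRedundant Rt) ∧
    ∀ R : Finset (α × α), G.IsMaxRedundant R ↔
      ∃ (Rt : Finset (α × α)) (Rintra : Fin K → Finset (α × α))
        (Rinter : Fin K → Fin K → Finset (α × α)),
        (G.condensation v).IsMaxRedundant Rt ∧
        (∀ k, (G.tightSubgraph (v k)).IsMaxRedundant (Rintra k)) ∧
        (∀ i j, i ≠ j →
          ((v i, v j) ∈ Rt → Rinter i j = G.edgesBetween (v i) (v j)) ∧
          ((v i, v j) ∉ Rt → (G.edgesBetween (v i) (v j)).Nonempty →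
            ∃ e ∈ G.interTight (v i) (v j),
              Rinter i j = G.edgesBetween (v i) (v j) \ {e}) ∧
          (G.edgesBetween (v i) (v j) = ∅ → Rinter i j = ∅)) ∧
        R = ((Finset.univ.filter fun q : Fin K × Fin K => q.1 ≠ q.2).biUnion
              fun q => Rinter q.1 q.2) ∪
            Finset.univ.biUnion fun k => G.intraSlack (v k) ∪ Rintra k := by
  rw [noNegClosedWalk_iff_noNeg] at hG
  have hRt := isMaxRedundant_iff_eq_replaceable (G := G.condensation v)
    fun u n r => condensation_closed_pos hG hv
  refine ⟨⟨_, (hRt _).mpr rfl, fun R hR => (hRt R).mp hR⟩, fun R => ?_⟩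
  rw [isMaxRedundant_iff_exists_blockShape hG hv]
  constructor
  · rintro ⟨S, hS, rfl⟩
    have hdiag : ∀ k, ∃ X, (G.tightSubgraph (v k)).IsMaxRedundant X ∧
        S (k, k) = G.intraSlack (v k) ∪ X := fun k => by
      have := hS (k, k)
      rwa [BlockShape, if_pos rfl] at this
    choose X hX hSX using hdiag
    refine ⟨_, X, fun i j => S (i, j), (hRt _).mpr rfl, hX, fun i j hij => ?_, ?_⟩
    · have := hS (i, j)
      rwa [BlockShape, if_neg hij] at this
    · ext e
      simp only [← hSX, Finset.mem_union, Finset.mem_biUnion, Finset.mem_filter, Finset.mem_univ,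
        true_and]
      constructor
      · rintro ⟨⟨i, j⟩, h⟩
        by_cases hij : i = j
        · subst hij
          exact .inr ⟨i, h⟩
        · exact .inl ⟨(i, j), hij, h⟩
      · rintro (⟨q, -, h⟩ | ⟨k, h⟩)
        · exact ⟨q, h⟩
        · exact ⟨(k, k), h⟩
  · rintro ⟨Rt, X, T, h₁, hX, hT, rfl⟩
    obtain rfl := (hRt Rt).mp h₁
    -- `T` is unconstrained on the diagonal and does not enter the union there, so the diagonal
    -- blocks take the intra-class sets instead.
    refine ⟨fun q => if q.1 = q.2 then G.intraSlack (v q.1) ∪ X q.1 else T q.1 q.2, ?_, ?_⟩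
    · rintro ⟨i, j⟩
      by_cases hij : i = j
      · simp only [BlockShape, hij, if_true]
        exact ⟨X j, hX j, rfl⟩
      · simp only [BlockShape, hij, if_false]
        exact hT i j hij
    · ext e
      simp only [Finset.mem_union (s := Finset.biUnion _ _), Finset.mem_biUnion,
        Finset.mem_filter, Finset.mem_univ, true_and]
      constructor
      · rintro (⟨q, hq, h⟩ | ⟨k, h⟩)
        · exact ⟨q, by rwa [if_neg hq]⟩
        · exact ⟨(k, k), by rwa [if_pos rfl]⟩
      · rintro ⟨q, h⟩
        split_ifs at h with hq
        · exact .inr ⟨q.1, h⟩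
        · exact .inl ⟨q, hq, h⟩
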